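/- **Setting.** A quantum circuit $C$ consists of finitely many locations $C_i$ (preparations, measurements, gates from a finite gate set, waits), arranged in time steps so that at each step every qubit present is involved in exactly one location; the first location of each qubit is a preparation and the last one is a measurement (and these occur nowhere else). Gates may be controlled by earlier measurement outcomes. Two locations are consecutive if they occur at adjacent time steps and share a qubit. A *fault-tolerant circuit* $C'$ for $C$, for a protocol based on a code that encodes one qubit per block of $n$ qubits and corrects $t$ errors, is the circuit obtained by replacing each $C_i$ by the protocol's gadget for the type of $C_i$ and inserting an error correction (EC) gadget on each qubit that passes from a location to a consecutive one. (Beyond this structure, no property of the gadgets is needed.) The *ExRec* of $C_i$ is the set of locations of $C'$ in the gadget for $C_i$, in the EC gadgets directly before it (leading ECs) and in those directly after it (trailing ECs). Given the set $S$ of faulty locations of $C'$, ExRecs are declared *good* or *bad* recursively from the end of the circuit: truncate the ExRec of $C_i$ by removing every trailing EC that is a leading EC of a bad ExRec; the ExRec of $C_i$ is bad if what remains contains more than $t$ elements of $S$, and good otherwise. An *error model* on a circuit replaces it at random by one of finitely many faulty circuits, each with its precise set of faulty locations: the locations outside this set act ideally, and at those inside it the error may be any quantum operation consistent with the causal structure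 (at each time step, a joint operation on the qubits of the faulty locations and a persistent ancilla). It *has error bounds* $(p_i)$ if for every set $R$ of locations the probability of faults on every location in $R$ (and possibly elsewhere) is at most $\prod_{i\in R}p_i$. It is *local stochastic* with error bounds $(p_i)$ if in addition $p_i<1$ for all $i$. **Theorem (Level Reduction).** Let $C'$ be a fault-tolerant circuit for $C$ subject to a local stochastic error model with error bounds $(p_j)$. Whenever the set of faults in $C'$ is $S$, replace $C$ by a circuit $\tilde C_S$ that is unchanged at every location $C_i$ whose ExRec is good and has an erroneous operation (of any kind, possibly using a persistent ancilla) at every $C_i$ whose ExRec is bad. The resulting error model on $C$ has the error bounds $$p'_i=\sum_{R}\ \prod_{j\in R}p_j ,$$ where $R$ ranges over the sets of exactly $t+1$ locations in the (full) ExRec of $C_i$; hence it is local stochastic with these bounds if $p'_i<1$ for all $i$. If moreover $p_j\le p$ for all $j$, where $p\ge 0$, then $p'_i\le A\,p^{t+1}$ for all $i$, where $A$ is the maximum over the types of ExRecs of the number of sets of exactly $t+1$ locations in the ExRec. In particular the model on $C$ has the uniform error bound $A\,p^{t+1}$, and is local stochastic with it if $A\,p^{t+1}<1$. -/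

import Mathlib

open scoped BigOperators Matrix ComplexOrder

noncomputable section

/-! ### Quantum circuits -/

/-- A finite set of elementary quantum gates, each with its number of qubits and its unitary.
Computational basis states of qubits labelled by `X` are functions `X → Bool`. -/
structure GateSet where
  Gate : Type
  [gateFintype : Fintype Gate]
  arity : Gate → ℕ
  op : (g : Gate) → Matrix (Fin (arity g) → Bool) (Fin (arity g) → Bool) ℂ
  op_unitary : ∀ g, op g ∈ Matrix.unitaryGroup (Fin (arity g) → Bool) ℂ

attribute [instance] GateSet.gateFintype

/-- The types of locations: preparation, measurement, wait, gate. -/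
inductive LocKind (G : GateSet) where
  | prep : LocKind G
  | meas : LocKind G
  | wait : LocKind G
  | gate (g : G.Gate) : LocKind G

namespace LocKind

variable {G : GateSet}

/-- Number of qubits involved in a location. -/
def arity : LocKind G → ℕ
  | prep => 1
  | meas => 1
  | wait => 1
  | gate g => G.arity g

/-- Number of qubits that enter a location (a preparation introduces a new qubit). -/
def numIn : LocKind G → ℕ
  | prep => 0
  | meas => 1
  | wait => 1
  | gate g => G.arity g

/-- Number of qubits that leave a location (a measurement removes its qubit). -/
def numOut : LocKind G → ℕ
  | prep => 1
  | meas => 0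
  | wait => 1
  | gate g => G.arity g

theorem numIn_le (k : LocKind G) : k.numIn ≤ k.arity := by
  cases k <;> simp [numIn, arity]

theorem numOut_le (k : LocKind G) : k.numOut ≤ k.arity := by
  cases k <;> simp [numOut, arity]

/-- Kraus operators (indexed by `r`) of the ideal operation of a location.  Preparation resets the
qubit to `|0⟩`, measurement is in the standard basis and leaves the outcome in its register, a gate
is applied if `on = true` and skipped otherwise (classical control). -/
def kraus : (k : LocKind G) → (on r : Bool) → Matrix (Fin k.arity → Bool) (Fin k.arity → Bool) ℂ
  | prep, _, r => Matrix.single (fun _ => false) (fun _ => r) 1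
  | meas, _, r => Matrix.single (fun _ => r) (fun _ => r) 1
  | wait, _, r => if r then 0 else 1
  | gate g, on, r => if r then 0 else if on then G.op g else 1

end LocKind

/-- A quantum circuit divided into time steps, possibly with input and output qubits.  Qubit `q`
is present from step `first q` to step `last q`, and at each of these steps it is involved in
exactly one location.  The first location of a qubit that is not an input is a preparation, the last
location of a qubit that is not an output is a measurement, and preparations and measurements occur
nowhere else. -/
structure OpenCircuit (G : GateSet) where
  Qubit : Type
  Loc : Type
  [qubitFintype : Fintype Qubit]
  [qubitDecEq : DecidableEq Qubit]
  [locFintype : Fintype Loc]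
  [locDecEq : DecidableEq Loc]
  kind : Loc → LocKind G
  time : Loc → ℕ
  wire : (i : Loc) → Fin (kind i).arity ↪ Qubit
  input : Set Qubit
  output : Set Qubit
  first : Qubit → ℕ
  last : Qubit → ℕ
  first_le_last : ∀ q, first q ≤ last q
  occupied : ∀ q s, first q ≤ s → s ≤ last q → ∃! i, time i = s ∧ q ∈ Set.range (wire i)
  lifetime : ∀ i a, first (wire i a) ≤ time i ∧ time i ≤ last (wire i a)
  prep_iff : ∀ i a, kind i = LocKind.prep ↔ time i = first (wire i a) ∧ wire i a ∉ input
  meas_iff : ∀ i a, kind i = LocKind.meas ↔ time i = last (wire i a) ∧ wire i a ∉ output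

attribute [instance] OpenCircuit.qubitFintype OpenCircuit.qubitDecEq
  OpenCircuit.locFintype OpenCircuit.locDecEq

/-- A complete quantum circuit: no input and no output qubits.  Gates may be controlled by perfect
classical processing of earlier measurement outcomes: `enabled i c` says whether the gate at `i` is
performed, where `c q` is the outcome of the measurement of qubit `q`. -/
structure Circuit (G : GateSet) extends OpenCircuit G where
  input_eq : input = ∅
  output_eq : output = ∅
  enabled : Loc → (Qubit → Bool) → Bool
  enabled_causal : ∀ i, DependsOn (enabled i) {q | last q < time i}

namespace Circuit

variable {G : GateSet}

/-- The outgoing qubits of the locations.  In a complete circuit each of them leads from a location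
to a consecutive one, and carries an error correction gadget in the fault-tolerant circuit. -/
abbrev Link (C : Circuit G) : Type := Σ i : C.Loc, Fin (C.kind i).numOut

/-- The link `l` enters the location `j` through its `b`-th incoming qubit: `l.1` and `j` are
consecutive and share this qubit. -/
def Feeds (C : Circuit G) (l : C.Link) (j : C.Loc) (b : Fin (C.kind j).numIn) : Prop :=
  C.time l.1 + 1 = C.time j ∧
    C.wire l.1 (Fin.castLE (C.kind l.1).numOut_le l.2) =
      C.wire j (Fin.castLE (C.kind j).numIn_le b)

/-! ### Faulty executions of a circuit -/

/-- Operators on the qubits of `C` together with an environment (ancilla) `Env`. -/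
abbrev Operator (C : Circuit G) (Env : Type) : Type :=
  Matrix ((C.Qubit → Bool) × Env) ((C.Qubit → Bool) × Env) ℂ

open Classical in
/-- Kraus operators of one ideal time step: the tensor product of the ideal operations of all
locations at time `s`, and the identity on all other qubits and on the environment. -/
def layerKraus (C : Circuit G) (Env : Type) (s : ℕ) (r : {i : C.Loc // C.time i = s} → Bool) :
    C.Operator Env :=
  Matrix.of fun x y =>
    if (∀ q, (∀ i, C.time i = s → q ∉ Set.range (C.wire i)) → x.1 q = y.1 q) ∧ x.2 = y.2 then
      ∏ i : {i : C.Loc // C.time i = s},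
        (C.kind i).kraus (C.enabled i y.1) (r i) (x.1 ∘ C.wire i) (y.1 ∘ C.wire i)
    else 0

open Classical in
/-- The ideal evolution during time step `s`. -/
def idealLayer (C : Circuit G) (Env : Type) [Fintype Env] (s : ℕ) (ρ : C.Operator Env) :
    C.Operator Env :=
  ∑ r : {i : C.Loc // C.time i = s} → Bool, C.layerKraus Env s r * ρ * (C.layerKraus Env s r)ᴴ

/-- The qubits involved at time `s` in locations of `S`. -/
def qubitsAt (C : Circuit G) (S : Finset C.Loc) (s : ℕ) : Set C.Qubit :=
  {q | ∃ i ∈ S, C.time i = s ∧ q ∈ Set.range (C.wire i)}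

open Classical in
/-- The operator acting as `K` on the qubits in `A` and on the environment, and as the identity on
the other qubits; `K` may be selected by the values of classical registers outside `A`. -/
def liftOp (C : Circuit G) {Env : Type} (A : Set C.Qubit)
    (K : (C.Qubit → Bool) → Matrix ((A → Bool) × Env) ((A → Bool) × Env) ℂ) : C.Operator Env :=
  Matrix.of fun x y =>
    if ∀ q, q ∉ A → x.1 q = y.1 q then
      K y.1 (fun q => x.1 q, x.2) (fun q => y.1 q, y.2)
    else 0

open Classical in
/-- `Φ` is a quantum operation (completely positive and trace preserving, given by Kraus operators)
acting on the qubits in `A` and the environment only.  It may depend on the outcomes of the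
measurements before time `s`. -/
def IsNoise (C : Circuit G) {Env : Type} [Fintype Env] (A : Set C.Qubit) (s : ℕ)
    (Φ : C.Operator Env → C.Operator Env) : Prop :=
  ∃ (m : ℕ) (K : Fin m → (C.Qubit → Bool) → Matrix ((A → Bool) × Env) ((A → Bool) × Env) ℂ),
    (∀ r, DependsOn (K r) {q | C.last q < s}) ∧
    (∀ c, ∑ r, (K r c)ᴴ * K r c = 1) ∧
    ∀ ρ, Φ ρ = ∑ r, C.liftOp A (K r) * ρ * (C.liftOp A (K r))ᴴ

/-- An execution of `C` with faults at the set `S` of locations: `C` with the locations in `S`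
replaced by erroneous operations.  The locations outside `S` act ideally.  The errors are arbitrary
quantum operations consistent with the causal structure: at each time step a joint operation on the
qubits of the faulty locations of this step and on an environment that keeps a quantum memory. -/
structure FaultyRun (C : Circuit G) (S : Finset C.Loc) where
  Env : Type
  [envFintype : Fintype Env]
  envInit : Matrix Env Env ℂ
  envInit_pos : envInit.PosSemidef
  envInit_trace : envInit.trace = 1
  step : ℕ → C.Operator Env → C.Operator Env
  step_eq : ∀ s, ∃ pre post : C.Operator Env → C.Operator Env,
    C.IsNoise (C.qubitsAt S s) s pre ∧ C.IsNoise (C.qubitsAt S s) s post ∧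
    ∀ ρ, step s ρ = post (C.idealLayer Env s (pre ρ))

/-! ### Error models -/

/-- A stochastic error model: with probability `prob ω` the circuit is replaced by the faulty circuit
`run ω`, which has faults at precisely the locations in `faults ω`. -/
structure ErrorModel (C : Circuit G) where
  Scenario : Type
  [scenarioFintype : Fintype Scenario]
  prob : Scenario → ℝ
  prob_nonneg : ∀ ω, 0 ≤ prob ω
  prob_sum : ∑ ω, prob ω = 1
  faults : Scenario → Finset C.Loc
  run : (ω : Scenario) → C.FaultyRun (faults ω)

attribute [instance] ErrorModel.scenarioFintype

namespace ErrorModel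

variable {C : Circuit G}

/-- The total probability of having faults on every location in `R` (and possibly elsewhere). -/
def probFaultyOn (E : C.ErrorModel) (R : Finset C.Loc) : ℝ :=
  ∑ ω with R ⊆ E.faults ω, E.prob ω

/-- The probability of faults on all of `R` is at most `∏_{i ∈ R} p i`, for every `R`. -/
def HasErrorBounds (E : C.ErrorModel) (p : C.Loc → ℝ) : Prop :=
  ∀ R : Finset C.Loc, E.probFaultyOn R ≤ ∏ i ∈ R, p i

/-- Local stochastic error model with error bounds `p i < 1`. -/
def IsLocalStochastic (E : C.ErrorModel) (p : C.Loc → ℝ) : Prop :=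
  (∀ i, p i < 1) ∧ E.HasErrorBounds p

end ErrorModel

end Circuit

/-! ### Fault-tolerant circuits -/

/-- A gadget acting on blocks of `n` physical qubits, with `nIn` incoming and `nOut` outgoing blocks.
All its other qubits are prepared and measured inside the gadget. -/
structure Gadget (H : GateSet) (n nIn nOut : ℕ) extends OpenCircuit H where
  inBlock : Fin nIn × Fin n ↪ Qubit
  outBlock : Fin nOut × Fin n ↪ Qubit
  input_eq : input = Set.range inBlock
  output_eq : output = Set.range outBlock

/-- A protocol for encoding circuits over the gate set `G` into circuits over the gate set `H`, using
a code with `n` physical qubits per block that corrects `t` errors: a gadget for each type of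
location, and an error correction gadget.  No further property of the gadgets (the diagrammatic
fault-tolerance conditions) is required, so fault-tolerant protocols are a special case. -/
structure FTProtocol (G H : GateSet) where
  n : ℕ
  t : ℕ
  gadget : (k : LocKind G) → Gadget H n k.numIn k.numOut
  ec : Gadget H n 1 1

namespace FTProtocol

variable {G H : GateSet}

/-- The gadgets that make up the fault-tolerant circuit for `C`: one for each location, and one error
correction gadget for each qubit passing from a location to a consecutive one. -/
def gadgetAt (P : FTProtocol G H) (C : Circuit G) : C.Loc ⊕ C.Link → OpenCircuit H
  | Sum.inl i => (P.gadget (C.kind i)).toOpenCircuit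
  | Sum.inr _ => P.ec.toOpenCircuit

/-- The number of locations in an ExRec of type `k`. -/
def exRecSize (P : FTProtocol G H) (k : LocKind G) : ℕ :=
  Fintype.card (P.gadget k).Loc + (k.numIn + k.numOut) * Fintype.card P.ec.Loc

/-- The maximum over the types of ExRecs of the number of sets of exactly `t + 1` locations. -/
def A (P : FTProtocol G H) : ℕ :=
  max (max ((P.exRecSize LocKind.prep).choose (P.t + 1))
        ((P.exRecSize LocKind.meas).choose (P.t + 1)))
    (max ((P.exRecSize LocKind.wait).choose (P.t + 1))
      (Finset.univ.sup fun g : G.Gate => (P.exRecSize (LocKind.gate g)).choose (P.t + 1)))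

end FTProtocol

/-- A fault-tolerant circuit for `C`: a circuit `C'` composed of the gadgets for the locations of `C`
and of error correction gadgets between consecutive locations.  Its locations are the disjoint
union of the locations of the gadgets (`loc`); each gadget is placed on some qubits of `C'`
(`qubit`) and starts at some time (`start`); the outgoing blocks of a gadget are the incoming blocks
of the following one, which takes them over at the next time step. -/
structure FTCircuit {G H : GateSet} (P : FTProtocol G H) (C : Circuit G) where
  C' : Circuit H
  loc : (Σ g : C.Loc ⊕ C.Link, (P.gadgetAt C g).Loc) ≃ C'.Loc
  qubit : (g : C.Loc ⊕ C.Link) → (P.gadgetAt C g).Qubit ↪ C'.Qubit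
  start : C.Loc ⊕ C.Link → ℕ
  kind_eq : ∀ g x, C'.kind (loc ⟨g, x⟩) = (P.gadgetAt C g).kind x
  time_eq : ∀ g x, C'.time (loc ⟨g, x⟩) = start g + (P.gadgetAt C g).time x
  wire_eq : ∀ g x (a : Fin (C'.kind (loc ⟨g, x⟩)).arity) (b : Fin ((P.gadgetAt C g).kind x).arity),
    (a : ℕ) = (b : ℕ) →
    C'.wire (loc ⟨g, x⟩) a = qubit g ((P.gadgetAt C g).wire x b)
  glue_out : ∀ (l : C.Link) (k : Fin P.n),
    qubit (Sum.inr l) (P.ec.inBlock (0, k)) =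
      qubit (Sum.inl l.1) ((P.gadget (C.kind l.1)).outBlock (l.2, k))
  glue_out_time : ∀ (l : C.Link) (k : Fin P.n),
    start (Sum.inr l) + P.ec.first (P.ec.inBlock (0, k)) =
      start (Sum.inl l.1) +
        (P.gadget (C.kind l.1)).last ((P.gadget (C.kind l.1)).outBlock (l.2, k)) + 1
  glue_in : ∀ (l : C.Link) (j : C.Loc) (b : Fin (C.kind j).numIn) (k : Fin P.n), C.Feeds l j b →
    qubit (Sum.inl j) ((P.gadget (C.kind j)).inBlock (b, k)) =
      qubit (Sum.inr l) (P.ec.outBlock (0, k))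
  glue_in_time : ∀ (l : C.Link) (j : C.Loc) (b : Fin (C.kind j).numIn) (k : Fin P.n),
    C.Feeds l j b →
    start (Sum.inl j) + (P.gadget (C.kind j)).first ((P.gadget (C.kind j)).inBlock (b, k)) =
      start (Sum.inr l) + P.ec.last (P.ec.outBlock (0, k)) + 1

namespace FTCircuit

variable {G H : GateSet} {P : FTProtocol G H} {C : Circuit G}

open Classical in
/-- The locations of the ExRec of `i`, truncated by omitting those trailing error correction gadgets
that are leading ones of a location in `B`: the leading error correction gadgets of `i`, the gadget
of `i`, and the remaining trailing error correction gadgets. -/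
def truncatedExRec (F : FTCircuit P C) (B : Set C.Loc) (i : C.Loc) : Finset F.C'.Loc :=
  Finset.univ.filter fun x =>
    match (F.loc.symm x).1 with
    | Sum.inl j => j = i
    | Sum.inr l => (∃ b, C.Feeds l i b) ∨ (l.1 = i ∧ ¬ ∃ j ∈ B, ∃ b, C.Feeds l j b)

/-- The full ExRec of `i`. -/
def exRec (F : FTCircuit P C) (i : C.Loc) : Finset F.C'.Loc := F.truncatedExRec ∅ i

/-- `F.IsBad S i`: for faults at precisely the locations in `S`, the (possibly truncated) ExRec of
`i` is bad, i.e. it contains more than `t` faulty locations, where a trailing error correction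
gadget is removed from the ExRec if it is a leading one of a bad ExRec.  This is a recursion starting
from the end of the circuit. -/
def IsBad (F : FTCircuit P C) (S : Finset F.C'.Loc) (i : C.Loc) : Prop :=
  P.t < (S ∩ F.truncatedExRec {j | ∃ _h : C.time i < C.time j, F.IsBad S j} i).card
termination_by Finset.univ.sup C.time - C.time i
decreasing_by
  have := Finset.le_sup (f := C.time) (Finset.mem_univ j)
  omega

/-- The recursion with the bad locations collected in one set. -/
theorem isBad_iff (F : FTCircuit P C) (S : Finset F.C'.Loc) (i : C.Loc) :
    F.IsBad S i ↔ P.t < (S ∩ F.truncatedExRec {j | F.IsBad S j} i).card := by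
  have key : F.truncatedExRec {j | ∃ _h : C.time i < C.time j, F.IsBad S j} i =
      F.truncatedExRec {j | F.IsBad S j} i := by
    ext x
    simp only [truncatedExRec, Finset.mem_filter, Finset.mem_univ, true_and]
    rcases (F.loc.symm x).1 with j | l
    · rfl
    · refine or_congr Iff.rfl (and_congr_right fun hl => not_congr ?_)
      constructor
      · rintro ⟨j, ⟨_, hj⟩, h⟩
        exact ⟨j, hj, h⟩
      · rintro ⟨j, hj, b, hb⟩
        refine ⟨j, ⟨?_, hj⟩, b, hb⟩
        have := hb.1
        rw [hl] at this
        omega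
  rw [IsBad, key]

open Classical in
/-- The locations of `C` whose ExRecs are bad when the faults are at precisely the set `S`. -/
def badLocs (F : FTCircuit P C) (S : Finset F.C'.Loc) : Finset C.Loc :=
  Finset.univ.filter fun i => F.IsBad S i

/-- The induced error model on `C`: when the faults of `C'` occur in scenario `ω`, with fault set
`S`, replace `C` by `Ct ω`, which coincides with `C` at the locations with a good ExRec and has an
erroneous operation at the locations with a bad ExRec. -/
def inducedModel (F : FTCircuit P C) (E : F.C'.ErrorModel)
    (Ct : (ω : E.Scenario) → C.FaultyRun (F.badLocs (E.faults ω))) : C.ErrorModel where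
  Scenario := E.Scenario
  prob := E.prob
  prob_nonneg := E.prob_nonneg
  prob_sum := E.prob_sum
  faults := fun ω => F.badLocs (E.faults ω)
  run := Ct

/-- The error bound of the induced model at the location `i`: the sum of `∏_{j ∈ R} p j` over all
sets `R` of exactly `t + 1` locations in the ExRec of `i`. -/
def inducedBound (F : FTCircuit P C) (p : F.C'.Loc → ℝ) (i : C.Loc) : ℝ :=
  ∑ R ∈ (F.exRec i).powersetCard (P.t + 1), ∏ j ∈ R, p j

end FTCircuit

end

/-!
If every location of a set `R₀` of `C` has a bad ExRec, then each of the corresponding truncated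
ExRecs contains `t + 1` faulty locations. Truncated ExRecs of distinct bad locations are disjoint
(`FTCircuit.disjoint_truncatedExRec`): an error correction gadget shared by two full ExRecs is a
trailing one of the first and a leading one of the second, and the badness of the second removes it
from the first. So the sets of `t + 1` faults can be chosen pairwise disjoint, and the error bounds
of `C'`, applied to their union, bound the probability of each choice by the product over `i ∈ R₀`
of the `∏ j ∈ Rᵢ, p j`. A union bound over all choices `(Rᵢ)` with `Rᵢ` in the full ExRec gives a sum
that factors into `∏ i ∈ R₀, p' i` (`Circuit.ErrorModel.HasErrorBounds.sum_prob_le`).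

For the uniform bound it suffices to count the locations of an ExRec: as a qubit is involved in only
one location at a time, each incoming qubit of a location is fed by at most one link, so that the
full ExRec has at most the number of locations prescribed by its type
(`FTCircuit.card_exRec_le`).
-/

/-! ### Consecutive locations -/

namespace OpenCircuit

variable {G : GateSet}

theorem loc_eq_of_wire_eq (C : OpenCircuit G) {i j : C.Loc} (ht : C.time i = C.time j)
    {a : Fin (C.kind i).arity} {b : Fin (C.kind j).arity} (h : C.wire i a = C.wire j b) :
    i = j :=
  (C.occupied _ _ (C.lifetime i a).1 (C.lifetime i a).2).unique ⟨rfl, a, rfl⟩ ⟨ht.symm, b, h.symm⟩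

end OpenCircuit

namespace Circuit

variable {G : GateSet} {C : Circuit G}

/-- A link enters at most one location. -/
theorem Feeds.loc_unique {l : C.Link} {i j : C.Loc} {a : Fin (C.kind i).numIn}
    {b : Fin (C.kind j).numIn} (hi : C.Feeds l i a) (hj : C.Feeds l j b) : i = j :=
  C.loc_eq_of_wire_eq (hi.1.symm.trans hj.1) (hi.2.symm.trans hj.2)

/-- An incoming qubit of a location is fed by at most one link. -/
theorem Feeds.link_unique {l m : C.Link} {i : C.Loc} {b : Fin (C.kind i).numIn}
    (hl : C.Feeds l i b) (hm : C.Feeds m i b) : l = m := by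
  obtain ⟨l, a⟩ := l
  obtain ⟨m, a'⟩ := m
  have hw := hl.2.trans hm.2.symm
  obtain rfl : l = m := C.loc_eq_of_wire_eq (Nat.succ_injective (hl.1.trans hm.1.symm)) hw
  obtain rfl : a = a' := Fin.castLE_injective _ ((C.wire l).injective hw)
  rfl

/-! ### Union bound over disjoint fault sets -/

namespace ErrorModel

variable {E : C.ErrorModel} {p : C.Loc → ℝ}

/-- Error bounds are nonnegative, since they bound the probabilities of single faults. -/
theorem HasErrorBounds.nonneg (hE : E.HasErrorBounds p) (i : C.Loc) : 0 ≤ p i := by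
  have h := hE {i}
  rw [Finset.prod_singleton] at h
  exact (Finset.sum_nonneg fun ω _ => E.prob_nonneg ω).trans h

theorem HasErrorBounds.mono {q : C.Loc → ℝ} (hE : E.HasErrorBounds p) (hpq : ∀ i, p i ≤ q i) :
    E.HasErrorBounds q := fun R =>
  (hE R).trans (Finset.prod_le_prod (fun i _ => hE.nonneg i) fun i _ => hpq i)

/-- If every scenario in `D` has `k` faults in each of the sets `X i`, `i ∈ s`, and these faults can
be chosen disjoint for distinct `i`, then the probability of `D` is bounded by the product over `i`
of the union bounds for `k` faults in `X i`. -/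
theorem HasErrorBounds.sum_prob_le {ι : Type*} [DecidableEq ι] (hE : E.HasErrorBounds p)
    (s : Finset ι) (X : ι → Finset C.Loc) (k : ℕ) (D : Finset E.Scenario)
    (hD : ∀ ω ∈ D, ∃ T : ι → Finset C.Loc,
      (∀ i ∈ s, T i ∈ (X i).powersetCard k ∧ T i ⊆ E.faults ω) ∧
        (s : Set ι).PairwiseDisjoint T) :
    ∑ ω ∈ D, E.prob ω ≤ ∏ i ∈ s, ∑ R ∈ (X i).powersetCard k, ∏ j ∈ R, p j := by
  classical
  let families := s.pi fun i => (X i).powersetCard k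
  let disjointFamilies := families.filter fun f =>
    (s.attach : Set s).PairwiseDisjoint fun i => f i.1 i.2
  let union (f : ∀ i ∈ s, Finset C.Loc) : Finset C.Loc := s.attach.biUnion fun i => f i.1 i.2
  calc
    ∑ ω ∈ D, E.prob ω
      ≤ ∑ ω ∈ D, ∑ f ∈ disjointFamilies, if union f ⊆ E.faults ω then E.prob ω else 0 := by
        refine Finset.sum_le_sum fun ω hω => ?_
        obtain ⟨T, hT, hdisj⟩ := hD ω hω
        have hmem : (fun i (_ : i ∈ s) => T i) ∈ disjointFamilies := by
          refine Finset.mem_filter.2 ⟨Finset.mem_pi.2 fun i hi => (hT i hi).1, ?_⟩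
          intro i _ j _ hij
          exact hdisj i.2 j.2 fun h => hij (Subtype.ext h)
        have hsub : union (fun i _ => T i) ⊆ E.faults ω :=
          Finset.biUnion_subset.2 fun i _ => (hT i.1 i.2).2
        refine le_trans (by rw [if_pos hsub]) (Finset.single_le_sum
          (f := fun f => if union f ⊆ E.faults ω then E.prob ω else 0) (fun f _ => ?_) hmem)
        split_ifs
        exacts [E.prob_nonneg ω, le_rfl]
    _ = ∑ f ∈ disjointFamilies, ∑ ω ∈ D, if union f ⊆ E.faults ω then E.prob ω else 0 :=
        Finset.sum_comm
    _ ≤ ∑ f ∈ disjointFamilies, E.probFaultyOn (union f) := by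
        refine Finset.sum_le_sum fun f _ => ?_
        rw [← Finset.sum_filter]
        exact Finset.sum_le_sum_of_subset_of_nonneg
          (Finset.filter_subset_filter _ (Finset.subset_univ D)) fun ω _ _ => E.prob_nonneg ω
    _ ≤ ∑ f ∈ disjointFamilies, ∏ i ∈ s.attach, ∏ j ∈ f i.1 i.2, p j := by
        -- Disjointness of the family makes the product over its union split.
        refine Finset.sum_le_sum fun f hf => (hE _).trans_eq ?_
        exact Finset.prod_biUnion (Finset.mem_filter.1 hf).2
    _ ≤ ∑ f ∈ families, ∏ i ∈ s.attach, ∏ j ∈ f i.1 i.2, p j :=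
        Finset.sum_le_sum_of_subset_of_nonneg (Finset.filter_subset _ _) fun f _ _ =>
          Finset.prod_nonneg fun i _ => Finset.prod_nonneg fun j _ => hE.nonneg j
    _ = ∏ i ∈ s, ∑ R ∈ (X i).powersetCard k, ∏ j ∈ R, p j := by
        rw [Finset.prod_sum]

end ErrorModel

end Circuit

/-! ### ExRecs -/

theorem FTProtocol.choose_exRecSize_le_A {G H : GateSet} (P : FTProtocol G H) (k : LocKind G) :
    (P.exRecSize k).choose (P.t + 1) ≤ P.A := by
  unfold FTProtocol.A
  cases k with
  | prep => exact (le_max_left _ _).trans (le_max_left _ _)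
  | meas => exact (le_max_right _ _).trans (le_max_left _ _)
  | wait => exact (le_max_left _ _).trans (le_max_right _ _)
  | gate g =>
    refine le_trans ?_ ((le_max_right _ _).trans (le_max_right _ _))
    exact Finset.le_sup (f := fun g : G.Gate => (P.exRecSize (LocKind.gate g)).choose (P.t + 1))
      (Finset.mem_univ g)

namespace FTCircuit

variable {G H : GateSet} {P : FTProtocol G H} {C : Circuit G}

theorem truncatedExRec_subset_exRec (F : FTCircuit P C) (B : Set C.Loc) (i : C.Loc) :
    F.truncatedExRec B i ⊆ F.exRec i := by
  intro x
  simp only [exRec, truncatedExRec, Finset.mem_filter, Finset.mem_univ, true_and]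
  rcases (F.loc.symm x).1 with j | l
  · exact id
  · exact Or.imp_right fun h => ⟨h.1, by simp⟩

/-- Truncation with respect to `B` makes the ExRecs of the locations in `B` disjoint. -/
theorem disjoint_truncatedExRec (F : FTCircuit P C) {B : Set C.Loc} {i j : C.Loc} (hi : i ∈ B)
    (hj : j ∈ B) (hij : i ≠ j) : Disjoint (F.truncatedExRec B i) (F.truncatedExRec B j) := by
  rw [Finset.disjoint_left]
  intro x
  simp only [truncatedExRec, Finset.mem_filter, Finset.mem_univ, true_and]
  rcases (F.loc.symm x).1 with k | l
  · exact fun h h' => hij (h.symm.trans h')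
  · rintro (⟨a, ha⟩ | ⟨hl, h⟩) (⟨b, hb⟩ | ⟨hl', h'⟩)
    · exact hij (ha.loc_unique hb)
    · exact h' ⟨i, hi, a, ha⟩
    · exact h ⟨j, hj, b, hb⟩
    · exact hij (hl.symm.trans hl')

/-- Each location of the ExRec of `i` lies in the gadget of `i`, or in the error correction gadget of
one of the `numIn` incoming or `numOut` outgoing qubits of `i`. -/
theorem card_exRec_le (F : FTCircuit P C) (i : C.Loc) :
    (F.exRec i).card ≤ P.exRecSize (C.kind i) := by
  classical
  let leading : Finset C.Link := Finset.univ.filter fun l => ∃ b, C.Feeds l i b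
  let trailing : Finset C.Link := Finset.univ.image (Sigma.mk i)
  have hleading : leading.card ≤ (C.kind i).numIn := by
    have h : ∀ l : leading, ∃ b, C.Feeds l.1 i b := fun l => (Finset.mem_filter.1 l.2).2
    choose f hf using h
    have hinj : Function.Injective f := fun l m hlm =>
      Subtype.ext ((hf l).link_unique (hlm ▸ hf m))
    simpa using Fintype.card_le_of_injective f hinj
  have htrailing : trailing.card ≤ (C.kind i).numOut :=
    Finset.card_image_le.trans_eq (by simp)
  let gadgetLocs : Finset F.C'.Loc :=
    Finset.univ.image fun x : (P.gadget (C.kind i)).Loc => F.loc ⟨Sum.inl i, x⟩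
  let ecLocs : Finset F.C'.Loc :=
    ((leading ∪ trailing) ×ˢ (Finset.univ : Finset P.ec.Loc)).image fun y =>
      F.loc ⟨Sum.inr y.1, y.2⟩
  have hsub : F.exRec i ⊆ gadgetLocs ∪ ecLocs := by
    intro x hx
    obtain ⟨⟨g, y⟩, rfl⟩ := F.loc.surjective x
    simp only [exRec, truncatedExRec, Finset.mem_filter, Finset.mem_univ, true_and,
      Equiv.symm_apply_apply] at hx
    rcases g with j | l
    · obtain rfl : j = i := hx
      exact Finset.mem_union_left _ (Finset.mem_image.2 ⟨y, Finset.mem_univ _, rfl⟩)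
    · have hl : l ∈ leading ∪ trailing := by
        rcases hx with h | ⟨rfl, -⟩
        · exact Finset.mem_union_left _ (Finset.mem_filter.2 ⟨Finset.mem_univ _, h⟩)
        · exact Finset.mem_union_right _ (Finset.mem_image.2 ⟨l.2, Finset.mem_univ _, rfl⟩)
      exact Finset.mem_union_right _ (Finset.mem_image.2
        ⟨(l, y), Finset.mem_product.2 ⟨hl, Finset.mem_univ _⟩, rfl⟩)
  calc
    (F.exRec i).card ≤ gadgetLocs.card + ecLocs.card :=
      (Finset.card_le_card hsub).trans (Finset.card_union_le _ _)
    _ ≤ Fintype.card (P.gadget (C.kind i)).Loc +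
          ((C.kind i).numIn + (C.kind i).numOut) * Fintype.card P.ec.Loc := by
      refine Nat.add_le_add Finset.card_image_le (Finset.card_image_le.trans ?_)
      rw [Finset.card_product, Finset.card_univ]
      exact Nat.mul_le_mul_right _
        ((Finset.card_union_le _ _).trans (Nat.add_le_add hleading htrailing))

/-! ### Level reduction -/

theorem probFaultyOn_inducedModel (F : FTCircuit P C) (E : F.C'.ErrorModel)
    (Ct : (ω : E.Scenario) → C.FaultyRun (F.badLocs (E.faults ω))) (R : Finset C.Loc) :
    (F.inducedModel E Ct).probFaultyOn R = ∑ ω with R ⊆ F.badLocs (E.faults ω), E.prob ω :=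
  rfl

theorem hasErrorBounds_inducedModel (F : FTCircuit P C) (E : F.C'.ErrorModel)
    {p : F.C'.Loc → ℝ} (hE : E.HasErrorBounds p)
    (Ct : (ω : E.Scenario) → C.FaultyRun (F.badLocs (E.faults ω))) :
    (F.inducedModel E Ct).HasErrorBounds (F.inducedBound p) := by
  intro R₀
  rw [F.probFaultyOn_inducedModel E Ct]
  refine hE.sum_prob_le R₀ F.exRec (P.t + 1) _ fun ω hω => ?_
  let B : Set C.Loc := {j | F.IsBad (E.faults ω) j}
  have hbad : ∀ i ∈ R₀, i ∈ B := fun i hi => by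
    simpa [B, badLocs] using (Finset.mem_filter.1 hω).2 hi
  have hT : ∀ i, ∃ T : Finset F.C'.Loc,
      i ∈ R₀ → T ⊆ E.faults ω ∩ F.truncatedExRec B i ∧ T.card = P.t + 1 := by
    intro i
    by_cases hi : i ∈ R₀
    · obtain ⟨T, hT⟩ := Finset.exists_subset_card_eq
        (Nat.succ_le_of_lt ((F.isBad_iff _ i).1 (hbad i hi)))
      exact ⟨T, fun _ => hT⟩
    · exact ⟨∅, fun h => absurd h hi⟩
  choose T hT using hT
  have htrunc : ∀ i ∈ R₀, T i ⊆ F.truncatedExRec B i := fun i hi =>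
    (hT i hi).1.trans Finset.inter_subset_right
  refine ⟨T, fun i hi => ⟨Finset.mem_powersetCard.2 ⟨?_, (hT i hi).2⟩,
    (hT i hi).1.trans Finset.inter_subset_left⟩, fun i hi j hj hij => ?_⟩
  · exact (htrunc i hi).trans (F.truncatedExRec_subset_exRec B i)
  · exact (F.disjoint_truncatedExRec (hbad i hi) (hbad j hj) hij).mono (htrunc i hi) (htrunc j hj)

theorem inducedBound_le (F : FTCircuit P C) {p : F.C'.Loc → ℝ} (hp : ∀ j, 0 ≤ p j) {p₀ : ℝ}
    (hp₀ : 0 ≤ p₀) (hpp₀ : ∀ j, p j ≤ p₀) (i : C.Loc) :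
    F.inducedBound p i ≤ (P.A : ℝ) * p₀ ^ (P.t + 1) := by
  have hterm : ∀ R ∈ (F.exRec i).powersetCard (P.t + 1), ∏ j ∈ R, p j ≤ p₀ ^ (P.t + 1) := by
    intro R hR
    rw [← (Finset.mem_powersetCard.1 hR).2]
    exact (Finset.prod_le_prod (fun j _ => hp j) fun j _ => hpp₀ j).trans_eq
      (Finset.prod_const p₀)
  calc
    F.inducedBound p i
      ≤ ((F.exRec i).card.choose (P.t + 1) : ℕ) * p₀ ^ (P.t + 1) := by
        rw [← Finset.card_powersetCard, ← nsmul_eq_mul]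
        exact Finset.sum_le_card_nsmul _ _ _ hterm
    _ ≤ (P.A : ℝ) * p₀ ^ (P.t + 1) := by
        gcongr
        exact (Nat.choose_le_choose _ (F.card_exRec_le i)).trans (P.choose_exRecSize_le_A _)

end FTCircuit

theorem mainTheorem2 {G H : GateSet} (P : FTProtocol G H) (C : Circuit G) (F : FTCircuit P C)
    (E : F.C'.ErrorModel) (p : F.C'.Loc → ℝ) (hE : E.IsLocalStochastic p)
    (Ct : (ω : E.Scenario) → C.FaultyRun (F.badLocs (E.faults ω))) :
    (F.inducedModel E Ct).HasErrorBounds (F.inducedBound p) ∧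
    ((∀ i, F.inducedBound p i < 1) →
      (F.inducedModel E Ct).IsLocalStochastic (F.inducedBound p)) ∧
    ∀ p₀ : ℝ, 0 ≤ p₀ → (∀ j, p j ≤ p₀) →
      (∀ i, F.inducedBound p i ≤ (P.A : ℝ) * p₀ ^ (P.t + 1)) ∧
      (F.inducedModel E Ct).HasErrorBounds (fun _ => (P.A : ℝ) * p₀ ^ (P.t + 1)) ∧
      ((P.A : ℝ) * p₀ ^ (P.t + 1) < 1 →
        (F.inducedModel E Ct).IsLocalStochastic (fun _ => (P.A : ℝ) * p₀ ^ (P.t + 1))) := by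
  have hbounds := F.hasErrorBounds_inducedModel E hE.2 Ct
  refine ⟨hbounds, fun h => ⟨h, hbounds⟩, fun p₀ hp₀ hp => ?_⟩
  have hle := F.inducedBound_le hE.2.nonneg hp₀ hp
  exact ⟨hle, hbounds.mono hle, fun h => ⟨fun _ => h, hbounds.mono hle⟩⟩
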